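/- **Setting.** Let $\mathbf{C}$ be a category and write $c\le d$ if there is a morphism $c\to d$, and $G_c=\operatorname{Aut}(c)$. A *weak push-out* of a span $c_1\leftarrow p\to c_2$ is a pullback square with corners $p,c_1,c_2,d$ that is initial among all pullback squares completing the span: for any pullback square $p,c_1,c_2,z$ on the same span there is a unique morphism $d\to z$ compatible with the maps from $c_1$ and $c_2$. Assume that $\mathbf{C}$ is *of $\mathrm{FI}$ type*: (1) all hom-sets are finite; (2) every morphism is a monomorphism and every endomorphism is an isomorphism; (3) $G_d$ acts transitively on $\operatorname{Hom}(c,d)$ for all $c,d$; (4) for every $d$ there are only finitely many isomorphism classes of objects $c\le d$; (5) $\mathbf{C}$ has pullbacks, and every span in $\mathbf{C}$ has a weak push-out. A *$\mathbf{C}$-module* is a functor $M_\bullet$ from $\mathbf{C}$ to complex vector spaces; it is *finitely generated* if some finite set of its elements is contained in no proper submodule. For a representation $V$ of $G_c$ put $\operatorname{Ind}_c(V)_d=\mathbb{C}[\operatorname{Hom}(c,d)]\otimes_{\mathbb{C}[G_c]}V$. A $\mathbf{C}$-module is *free* if it is isomorphic to a finite direct sum $\bigoplus_i\operatorname{Ind}_{c_i}(V_i)$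 with $V_i$ finite-dimensional, and, with respect to such a presentation, its *dual* is $F^*=\bigoplus_i\operatorname{Ind}_{c_i}(V_i^*)$. The dual is paired with $F$ by $\langle f\otimes\varphi,\,g\otimes x\rangle=\sum_{\psi\in G_c,\ f\circ\psi=g}\varphi(\psi x)$ on each summand $\operatorname{Ind}_c(V^*)_d\times\operatorname{Ind}_c(V)_d$, distinct summands being orthogonal. Tensor products are taken over $\mathbb{C}$, objectwise. By (3), every morphism $f:c\to d$ induces a map on coinvariants $M_c/G_c\to M_d/G_d$. Say that *the coinvariants of $M$ stabilize* if there is a set $X$ of objects that is upward closed ($c\in X$ and $c\le d$ imply $d\in X$) and cofinal (for every object $e$ there is $c\in X$ with $e\le c$) such that for all $c\in X$ and all morphisms $c\to d$ the induced map $M_c/G_c\to M_d/G_d$ is an isomorphism. **Theorem.** Let $M$ be a finitely generated $\mathbf{C}$-module over $\mathbb{C}$, where $\mathbf{C}$ is of $\mathrm{FI}$ type. 1. The coinvariants of $M$ stabilize. 2. For every free $\mathbf{C}$-module $F$, the coinvariants of $F\otimes M$ stabilize. 3. For every free $\mathbf{C}$-module $F$ (with a chosen presentation as a finite direct sum of induction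 modules), the spaces $\operatorname{Hom}_{G_c}(F_c,M_c)$ stabilize: for every object $c$ the canonical map $$\alpha_c:(F^*_c\otimes M_c)/G_c\to\operatorname{Hom}_{G_c}(F_c,M_c),\qquad [\varphi\otimes m]\mapsto\frac1{|G_c|}\sum_{g\in G_c} g\circ\bigl(x\mapsto\langle\varphi,x\rangle m\bigr)\circ g^{-1},$$ is an isomorphism, and there is an upward closed and cofinal set $X$ of objects such that for all $c\in X$ and all morphisms $f:c\to d$ the map $\operatorname{Hom}_{G_c}(F_c,M_c)\to\operatorname{Hom}_{G_d}(F_d,M_d)$ that corresponds under $\alpha_c,\alpha_d$ to the map on coinvariants of $F^*\otimes M$ induced by $f$ is an isomorphism. -/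

import Mathlib

open CategoryTheory CategoryTheory.Limits
open scoped TensorProduct

universe u v w w₁ w₂

/-- A weak push-out square: a pullback square which is initial among the pullback squares
completing the span `f₁, f₂`. -/
def IsWeakPushout {C : Type u} [Category.{v} C] {p c₁ c₂ d : C}
    (f₁ : p ⟶ c₁) (f₂ : p ⟶ c₂) (g₁ : c₁ ⟶ d) (g₂ : c₂ ⟶ d) : Prop :=
  IsPullback f₁ f₂ g₁ g₂ ∧
    ∀ (z : C) (h₁ : c₁ ⟶ z) (h₂ : c₂ ⟶ z), IsPullback f₁ f₂ h₁ h₂ →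
      ∃! h : d ⟶ z, g₁ ≫ h = h₁ ∧ g₂ ≫ h = h₂

/-- Categories of `FI` type. -/
class IsFIType (C : Type u) [Category.{v} C] : Prop where
  finite_hom : ∀ c d : C, Finite (c ⟶ d)
  mono : ∀ {c d : C} (f : c ⟶ d), Mono f
  endo_isIso : ∀ {c : C} (f : c ⟶ c), IsIso f
  transitive : ∀ {c d : C} (f g : c ⟶ d), ∃ σ : Aut d, f ≫ σ.hom = g
  /-- Up to isomorphism, only finitely many objects map to `d`. -/
  finite_below : ∀ d : C, ∃ S : Finset C, ∀ c : C, Nonempty (c ⟶ d) → ∃ s ∈ S, Nonempty (c ≅ s)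
  hasPullbacks : HasPullbacks C
  weakPushout : ∀ {p c₁ c₂ : C} (f₁ : p ⟶ c₁) (f₂ : p ⟶ c₂),
    ∃ (d : C) (g₁ : c₁ ⟶ d) (g₂ : c₂ ⟶ d), IsWeakPushout f₁ f₂ g₁ g₂

/-- The automorphism groups of a category of `FI` type are finite. -/
noncomputable instance autFintype {C : Type u} [Category.{v} C] [IsFIType C] (c : C) :
    Fintype (Aut c) :=
  haveI := IsFIType.finite_hom c c
  haveI : Finite (Aut c) := Finite.of_injective (fun g : Aut c => g.hom) fun _ _ h => Iso.ext h
  Fintype.ofFinite _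

section CModules

variable {C : Type u} [Category.{v} C]

/-- The representation of `G_c = Aut c` on the value `M_c` of a `C`-module `M`. -/
def autRep (M : C ⥤ ModuleCat.{w} ℂ) (c : C) : Representation ℂ (Aut c) (M.obj c) where
  toFun g := (M.map g.hom).hom
  map_one' := by
    change (M.map (𝟙 c)).hom = _
    rw [M.map_id]; rfl
  map_mul' g h := by
    change (M.map (h.hom ≫ g.hom)).hom = _
    rw [M.map_comp]; rfl

/-- A `C`-module is finitely generated if some finite set of its elements is contained in no
proper `C`-submodule. -/
def IsFinitelyGenerated (M : C ⥤ ModuleCat.{w} ℂ) : Prop :=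
  ∃ S : Finset (Σ c : C, M.obj c), ∀ N : ∀ c : C, Submodule ℂ (M.obj c),
    (∀ (c d : C) (f : c ⟶ d), ∀ x ∈ N c, (M.map f).hom x ∈ N d) →
    (∀ s ∈ S, s.2 ∈ N s.1) → ∀ c : C, N c = ⊤

/-- The pointwise tensor product over `ℂ` of two `C`-modules. -/
def tensorModule (M : C ⥤ ModuleCat.{w₁} ℂ) (N : C ⥤ ModuleCat.{w₂} ℂ) :
    C ⥤ ModuleCat.{max w₁ w₂} ℂ where
  obj c := ModuleCat.of ℂ (M.obj c ⊗[ℂ] N.obj c)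
  map f := ModuleCat.ofHom (TensorProduct.map (M.map f).hom (N.map f).hom)
  map_id c := by
    ext : 1
    simp
  map_comp f g := by
    ext : 1
    simp [TensorProduct.map_comp]

/-- The coinvariant quotient `M_c / G_c`. -/
abbrev Coinv (M : C ⥤ ModuleCat.{w} ℂ) (c : C) : Type w :=
  (autRep M c).Coinvariants

/-- The map `M_c / G_c → M_d / G_d` induced by a morphism `f : c ⟶ d`. -/
noncomputable def coinvMap [IsFIType C] (M : C ⥤ ModuleCat.{w} ℂ) {c d : C} (f : c ⟶ d) :
    Coinv M c →ₗ[ℂ] Coinv M d :=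
  Representation.Coinvariants.lift (autRep M c)
    (Representation.Coinvariants.mk (autRep M d) ∘ₗ (M.map f).hom) (by
      intro g
      obtain ⟨σ, hσ⟩ := IsFIType.transitive f (g.hom ≫ f)
      ext x
      have h : (M.map f).hom (autRep M c g x) = autRep M d σ ((M.map f).hom x) := by
        change (M.map f).hom ((M.map g.hom).hom x) = (M.map σ.hom).hom ((M.map f).hom x)
        rw [← LinearMap.comp_apply, ← LinearMap.comp_apply, ← ModuleCat.hom_comp,
          ← ModuleCat.hom_comp, ← M.map_comp, ← M.map_comp, hσ]
      simp [h])

/-- A set of objects is upward closed for the preorder `c ≤ d ↔ Nonempty (c ⟶ d)`. -/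
def IsUpwardClosed (X : Set C) : Prop :=
  ∀ c d : C, c ∈ X → Nonempty (c ⟶ d) → d ∈ X

/-- A set of objects is cofinal for the preorder `c ≤ d ↔ Nonempty (c ⟶ d)`. -/
def IsCofinalSet (X : Set C) : Prop :=
  ∀ e : C, ∃ c ∈ X, Nonempty (e ⟶ c)

/-- The coinvariants of `M` stabilize: on an upward closed and cofinal set of objects,
all induced maps between coinvariants are isomorphisms. -/
def CoinvariantsStabilize [IsFIType C] (M : C ⥤ ModuleCat.{w} ℂ) : Prop :=
  ∃ X : Set C, IsUpwardClosed X ∧ IsCofinalSet X ∧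
    ∀ c ∈ X, ∀ (d : C) (f : c ⟶ d), Function.Bijective (coinvMap M f)

/-- The relations `(f ∘ g) ⊗ x = f ⊗ g x`, for `g ∈ G_c`, which cut out
`ℂ[Hom(c, d)] ⊗_{G_c} V` as a quotient of `ℂ[Hom(c, d)] ⊗ V = (Hom(c, d) →₀ V)`. -/
noncomputable def indRel {c : C} {V : Type w} [AddCommGroup V] [Module ℂ V]
    (ρ : Representation ℂ (Aut c) V) (d : C) : Submodule ℂ ((c ⟶ d) →₀ V) :=
  Submodule.span ℂ (Set.range fun t : Aut c × (c ⟶ d) × V =>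
    Finsupp.single (t.1.hom ≫ t.2.1) t.2.2 - Finsupp.single t.2.1 (ρ t.1 t.2.2))

/-- `Ind_c(V)_d = ℂ[Hom(c, d)] ⊗_{G_c} V`. -/
abbrev IndObj {c : C} {V : Type w} [AddCommGroup V] [Module ℂ V]
    (ρ : Representation ℂ (Aut c) V) (d : C) : Type (max v w) :=
  ((c ⟶ d) →₀ V) ⧸ indRel ρ d

theorem indRel_le_comap {c : C} {V : Type w} [AddCommGroup V] [Module ℂ V]
    (ρ : Representation ℂ (Aut c) V) {d e : C} (h : d ⟶ e) :
    indRel ρ d ≤ (indRel ρ e).comap (Finsupp.lmapDomain V ℂ fun f : c ⟶ d => f ≫ h) := by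
  refine Submodule.span_le.2 ?_
  rintro _ ⟨⟨g, f, x⟩, rfl⟩
  refine Submodule.subset_span ⟨(g, f ≫ h, x), ?_⟩
  simp [Finsupp.mapDomain_sub, Finsupp.mapDomain_single]

/-- Postcomposition with `h : d ⟶ e` as a map `Ind_c(V)_d → Ind_c(V)_e`. -/
noncomputable def indMap {c : C} {V : Type w} [AddCommGroup V] [Module ℂ V]
    (ρ : Representation ℂ (Aut c) V) {d e : C} (h : d ⟶ e) : IndObj ρ d →ₗ[ℂ] IndObj ρ e :=
  Submodule.mapQ (indRel ρ d) (indRel ρ e) (Finsupp.lmapDomain V ℂ fun f : c ⟶ d => f ≫ h)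
    (indRel_le_comap ρ h)

theorem indMap_mk {c : C} {V : Type w} [AddCommGroup V] [Module ℂ V]
    (ρ : Representation ℂ (Aut c) V) {d e : C} (h : d ⟶ e) (y : (c ⟶ d) →₀ V) :
    indMap ρ h (Submodule.Quotient.mk y) =
      Submodule.Quotient.mk (Finsupp.mapDomain (fun f : c ⟶ d => f ≫ h) y) := rfl

theorem indMap_id {c : C} {V : Type w} [AddCommGroup V] [Module ℂ V]
    (ρ : Representation ℂ (Aut c) V) (d : C) (x : IndObj ρ d) : indMap ρ (𝟙 d) x = x := by
  obtain ⟨y, rfl⟩ := Submodule.Quotient.mk_surjective _ x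
  rw [indMap_mk]
  simp only [Category.comp_id]
  exact congrArg _ Finsupp.mapDomain_id

theorem indMap_comp {c : C} {V : Type w} [AddCommGroup V] [Module ℂ V]
    (ρ : Representation ℂ (Aut c) V) {d e z : C} (h : d ⟶ e) (k : e ⟶ z) (x : IndObj ρ d) :
    indMap ρ (h ≫ k) x = indMap ρ k (indMap ρ h x) := by
  obtain ⟨y, rfl⟩ := Submodule.Quotient.mk_surjective _ x
  rw [indMap_mk, indMap_mk, indMap_mk, ← Finsupp.mapDomain_comp]
  simp [Function.comp_def]

end CModules

/-- The data presenting a free `C`-module as a finite direct sum `⊕ᵢ Ind_{cᵢ}(Vᵢ)`, with each `Vᵢ`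
a finite-dimensional representation of `G_{cᵢ}`. -/
structure FreeData (C : Type u) [Category.{v} C] where
  n : ℕ
  base : Fin n → C
  V : Fin n → Type w
  [addCommGroup : ∀ i, AddCommGroup (V i)]
  [module : ∀ i, Module ℂ (V i)]
  [finiteDimensional : ∀ i, FiniteDimensional ℂ (V i)]
  rep : ∀ i, Representation ℂ (Aut (base i)) (V i)

attribute [instance] FreeData.addCommGroup FreeData.module FreeData.finiteDimensional

section Free

variable {C : Type u} [Category.{v} C]

/-- The direct sum `⊕ᵢ Ind_{cᵢ}(Vᵢ)` (over a finite index set, hence a product). -/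
noncomputable def FreeData.toModule (P : FreeData.{u, v, w} C) :
    C ⥤ ModuleCat.{max v w} ℂ where
  obj d := ModuleCat.of ℂ (∀ i, IndObj (P.rep i) d)
  map h := ModuleCat.ofHom (LinearMap.pi fun i => indMap (P.rep i) h ∘ₗ LinearMap.proj i)
  map_id d := ModuleCat.hom_ext (LinearMap.ext fun x => funext fun i =>
    indMap_id (P.rep i) d (x i))
  map_comp h k := ModuleCat.hom_ext (LinearMap.ext fun x => funext fun i =>
    indMap_comp (P.rep i) h k (x i))

/-- A `C`-module is free if it is isomorphic to a finite direct sum of induction modules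
`Ind_c(V)` of finite-dimensional representations. -/
def IsFreeModule (F : C ⥤ ModuleCat.{max v w} ℂ) : Prop :=
  ∃ P : FreeData.{u, v, w} C, Nonempty (F ≅ P.toModule)

/-- The data of the dual free module `⊕ᵢ Ind_{cᵢ}(Vᵢ*)`. -/
def FreeData.dual (P : FreeData.{u, v, w} C) : FreeData.{u, v, w} C where
  n := P.n
  base := P.base
  V i := Module.Dual ℂ (P.V i)
  rep i := (P.rep i).dual

open Classical in
/-- The bilinear form `⟨f ⊗ φ, g ⊗ x⟩ = ∑_{ψ ∈ G_c, f ∘ ψ = g} φ (ψ x)`, before passing to the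
quotients over `G_c`. -/
noncomputable def rawPairing [IsFIType C] {c : C} {V : Type w} [AddCommGroup V] [Module ℂ V]
    (ρ : Representation ℂ (Aut c) V) (d : C) :
    ((c ⟶ d) →₀ Module.Dual ℂ V) →ₗ[ℂ] ((c ⟶ d) →₀ V) →ₗ[ℂ] ℂ :=
  Finsupp.lsum ℂ fun f => LinearMap.flip (Finsupp.lsum ℂ fun g =>
    ∑ ψ : Aut c, if ψ.hom ≫ f = g then Module.Dual.eval ℂ V ∘ₗ ρ ψ else 0)

open Classical in
theorem rawPairing_single [IsFIType C] {c : C} {V : Type w} [AddCommGroup V] [Module ℂ V]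
    (ρ : Representation ℂ (Aut c) V) (d : C) (f g : c ⟶ d) (φ : Module.Dual ℂ V) (x : V) :
    rawPairing ρ d (Finsupp.single f φ) (Finsupp.single g x) =
      ∑ ψ : Aut c, if ψ.hom ≫ f = g then φ (ρ ψ x) else 0 := by
  simp only [rawPairing, Finsupp.lsum_single, LinearMap.flip_apply, LinearMap.sum_apply]
  refine Finset.sum_congr rfl fun ψ _ => ?_
  split_ifs <;> simp

theorem rawPairing_right [IsFIType C] {c : C} {V : Type w} [AddCommGroup V] [Module ℂ V]
    (ρ : Representation ℂ (Aut c) V) (d : C) (a : (c ⟶ d) →₀ Module.Dual ℂ V) :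
    indRel ρ d ≤ LinearMap.ker (rawPairing ρ d a) := by
  classical
  refine Submodule.span_le.2 ?_
  rintro _ ⟨⟨τ, g, x⟩, rfl⟩
  simp only [SetLike.mem_coe, LinearMap.mem_ker, map_sub, sub_eq_zero]
  induction a using Finsupp.induction_linear with
  | zero => simp
  | add a b ha hb => simp [ha, hb]
  | single f φ =>
    rw [rawPairing_single, rawPairing_single]
    refine (Fintype.sum_equiv (Equiv.mulRight τ) _ _ fun ψ => ?_).symm
    have h : ((ψ * τ : Aut c).hom ≫ f = τ.hom ≫ g) ↔ ψ.hom ≫ f = g := by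
      rw [show (ψ * τ : Aut c).hom = τ.hom ≫ ψ.hom from rfl, Category.assoc]
      exact Iso.cancel_iso_hom_left (show c ≅ c from τ) _ _
    simp [h]

theorem rawPairing_left [IsFIType C] {c : C} {V : Type w} [AddCommGroup V] [Module ℂ V]
    (ρ : Representation ℂ (Aut c) V) (d : C) :
    indRel ρ.dual d ≤ LinearMap.ker (rawPairing ρ d) := by
  classical
  refine Submodule.span_le.2 ?_
  rintro _ ⟨⟨τ, f, φ⟩, rfl⟩
  simp only [SetLike.mem_coe, LinearMap.mem_ker, map_sub, sub_eq_zero]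
  ext g x
  simp only [LinearMap.comp_apply, Finsupp.lsingle_apply]
  rw [rawPairing_single, rawPairing_single]
  refine Fintype.sum_equiv (Equiv.mulLeft τ) _ _ fun ψ => ?_
  simp [show (τ * ψ : Aut c).hom = ψ.hom ≫ τ.hom from rfl, Module.Dual.transpose_apply]

/-- The pairing `Ind_c(V*)_d × Ind_c(V)_d → ℂ`,
`⟨f ⊗ φ, g ⊗ x⟩ = ∑_{ψ ∈ G_c, f ∘ ψ = g} φ (ψ x)`. -/
noncomputable def indPairing [IsFIType C] {c : C} {V : Type w} [AddCommGroup V] [Module ℂ V]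
    (ρ : Representation ℂ (Aut c) V) (d : C) :
    IndObj ρ.dual d →ₗ[ℂ] IndObj ρ d →ₗ[ℂ] ℂ :=
  LinearMap.flip (Submodule.liftQ (indRel ρ d)
    (LinearMap.flip (Submodule.liftQ (indRel ρ.dual d) (rawPairing ρ d) (rawPairing_left ρ d)))
    (by
      intro y hy
      rw [LinearMap.mem_ker]
      ext a
      exact rawPairing_right ρ d _ hy))

theorem indPairing_map [IsFIType C] {c : C} {V : Type w} [AddCommGroup V] [Module ℂ V]
    (ρ : Representation ℂ (Aut c) V) {d e : C} (h : d ⟶ e) (a : IndObj ρ.dual d)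
    (x : IndObj ρ d) : indPairing ρ e (indMap ρ.dual h a) (indMap ρ h x) = indPairing ρ d a x := by
  classical
  obtain ⟨a, rfl⟩ := Submodule.Quotient.mk_surjective _ a
  obtain ⟨x, rfl⟩ := Submodule.Quotient.mk_surjective _ x
  change rawPairing ρ e (Finsupp.mapDomain _ a) (Finsupp.mapDomain _ x) = rawPairing ρ d a x
  induction a using Finsupp.induction_linear with
  | zero => simp
  | add a b ha hb => simp [Finsupp.mapDomain_add, ha, hb]
  | single f φ =>
    induction x using Finsupp.induction_linear with
    | zero => simp
    | add a b ha hb => simp only [Finsupp.mapDomain_add, map_add, ha, hb]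
    | single g x =>
      have := IsFIType.mono h
      rw [Finsupp.mapDomain_single, Finsupp.mapDomain_single, rawPairing_single, rawPairing_single]
      refine Finset.sum_congr rfl fun ψ _ => ?_
      rw [← Category.assoc, cancel_mono]

/-- The evaluation pairing `(F*)_d × F_d → ℂ` of a free module with its dual: distinct summands
are orthogonal. -/
noncomputable def FreeData.pairing [IsFIType C] (P : FreeData.{u, v, w} C) (d : C) :
    P.dual.toModule.obj d →ₗ[ℂ] P.toModule.obj d →ₗ[ℂ] ℂ :=
  ∑ i : Fin P.n, (indPairing (P.rep i) d).compl₁₂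
    (LinearMap.proj (R := ℂ) (φ := fun i => IndObj (P.rep i).dual d) i)
    (LinearMap.proj (R := ℂ) (φ := fun i => IndObj (P.rep i) d) i)

theorem FreeData.pairing_map [IsFIType C] (P : FreeData.{u, v, w} C) {d e : C} (h : d ⟶ e)
    (a : P.dual.toModule.obj d) (x : P.toModule.obj d) :
    P.pairing e ((P.dual.toModule.map h).hom a) ((P.toModule.map h).hom x) = P.pairing d a x := by
  simp only [FreeData.pairing, LinearMap.sum_apply]
  exact Finset.sum_congr rfl fun i _ => indPairing_map (P.rep i) h _ _

/-- The contraction `(F*)_d ⊗ M_d → Hom_ℂ(F_d, M_d)`, `φ ⊗ m ↦ (x ↦ ⟨φ, x⟩ m)`, where `F` is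
identified with `⊕ᵢ Ind_{cᵢ}(Vᵢ)` through `e`. -/
noncomputable def contraction [IsFIType C] {F : C ⥤ ModuleCat.{max v w} ℂ}
    (P : FreeData.{u, v, w} C) (e : F ≅ P.toModule) (M : C ⥤ ModuleCat.{w₁} ℂ) (d : C) :
    (tensorModule P.dual.toModule M).obj d →ₗ[ℂ] (F.obj d →ₗ[ℂ] M.obj d) :=
  dualTensorHom ℂ (F.obj d) (M.obj d) ∘ₗ
    LinearMap.rTensor (M.obj d) ((P.pairing d).compl₂ (e.hom.app d).hom)

theorem contraction_autRep [IsFIType C] {F : C ⥤ ModuleCat.{max v w} ℂ}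
    (P : FreeData.{u, v, w} C) (e : F ≅ P.toModule) (M : C ⥤ ModuleCat.{w₁} ℂ) (d : C)
    (g : Aut d) (t : (tensorModule P.dual.toModule M).obj d) :
    contraction P e M d (autRep (tensorModule P.dual.toModule M) d g t) =
      Representation.linHom (autRep F d) (autRep M d) g (contraction P e M d t) := by
  have key : contraction P e M d ∘ₗ autRep (tensorModule P.dual.toModule M) d g =
      Representation.linHom (autRep F d) (autRep M d) g ∘ₗ contraction P e M d := by
    refine TensorProduct.ext' (M := P.dual.toModule.obj d) (N := M.obj d) fun a m => ?_
    ext x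
    have hx : (P.toModule.map g.hom).hom ((e.hom.app d).hom (autRep F d g⁻¹ x)) =
        (e.hom.app d).hom x := by
      have h := congrArg (fun k => k.hom (autRep F d g⁻¹ x)) (e.hom.naturality g.hom)
      simp only [ModuleCat.hom_comp, LinearMap.comp_apply] at h
      rw [← h]
      exact congrArg _ (Representation.self_inv_apply (autRep F d) g x)
    have hp := P.pairing_map g.hom a ((e.hom.app d).hom (autRep F d g⁻¹ x))
    rw [hx] at hp
    change P.pairing d ((P.dual.toModule.map g.hom).hom a) ((e.hom.app d).hom x) •
      (M.map g.hom).hom m = autRep M d g (P.pairing d a ((e.hom.app d).hom (autRep F d g⁻¹ x)) • m)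
    rw [hp, map_smul]
    rfl
  exact LinearMap.congr_fun key t

/-- Averaging over a finite group `G`: the map `T ↦ |G|⁻¹ ∑_{g ∈ G} g ∘ T ∘ g⁻¹` from linear maps to
`G`-equivariant ones. -/
noncomputable def averageHom {G : Type*} [Group G] [Fintype G] {V W : Type*} [AddCommGroup V]
    [Module ℂ V] [AddCommGroup W] [Module ℂ W] (ρ : Representation ℂ G V)
    (σ : Representation ℂ G W) : (V →ₗ[ℂ] W) →ₗ[ℂ] ρ.IntertwiningMap σ :=
  (Representation.invariantsEquivIntertwiningMap ρ σ).toLinearMap ∘ₗ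
    LinearMap.codRestrict (ρ.linHom σ).invariants
      ((Fintype.card G : ℂ)⁻¹ • ∑ g : G, ρ.linHom σ g) (by
        intro T h
        rw [LinearMap.smul_apply, LinearMap.sum_apply, map_smul, map_sum]
        congr 1
        refine Fintype.sum_equiv (Equiv.mulLeft h) _ _ fun g => ?_
        rw [Equiv.coe_mulLeft, map_mul]
        rfl)

theorem averageHom_linHom {G : Type*} [Group G] [Fintype G] {V W : Type*} [AddCommGroup V]
    [Module ℂ V] [AddCommGroup W] [Module ℂ W] (ρ : Representation ℂ G V)
    (σ : Representation ℂ G W) (h : G) (T : V →ₗ[ℂ] W) :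
    averageHom ρ σ (ρ.linHom σ h T) = averageHom ρ σ T := by
  refine congrArg (Representation.invariantsEquivIntertwiningMap ρ σ) (Subtype.ext ?_)
  change ((Fintype.card G : ℂ)⁻¹ • ∑ g : G, ρ.linHom σ g) (ρ.linHom σ h T) =
    ((Fintype.card G : ℂ)⁻¹ • ∑ g : G, ρ.linHom σ g) T
  rw [LinearMap.smul_apply, LinearMap.smul_apply, LinearMap.sum_apply, LinearMap.sum_apply]
  congr 1
  refine Fintype.sum_equiv (Equiv.mulRight h) _ _ fun g => ?_
  rw [Equiv.coe_mulRight, map_mul]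
  rfl

/-- The canonical map `((F*)_d ⊗ M_d) / G_d → Hom_{G_d}(F_d, M_d)`: contract, then average over
`G_d`. -/
noncomputable def coinvToHom [IsFIType C] {F : C ⥤ ModuleCat.{max v w} ℂ}
    (P : FreeData.{u, v, w} C) (e : F ≅ P.toModule) (M : C ⥤ ModuleCat.{w₁} ℂ) (d : C) :
    Coinv (tensorModule P.dual.toModule M) d →ₗ[ℂ]
      (autRep F d).IntertwiningMap (autRep M d) :=
  Representation.Coinvariants.lift (autRep (tensorModule P.dual.toModule M) d)
    (averageHom (autRep F d) (autRep M d) ∘ₗ contraction P e M d)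
    (fun g => LinearMap.ext fun t =>
      (congrArg _ (contraction_autRep P e M d g t)).trans (averageHom_linHom _ _ g _))

end Free

/-! Every morphism `c ⟶ d` induces the same map on coinvariants, since `G_d` permutes these
morphisms transitively. Hence, for a finitely generated `M`, the maps on coinvariants are surjective
above an object past which no generator becomes newly visible; there the dimension of the
coinvariants cannot increase, and above an object of minimal dimension the maps are bijective.

Tensor products of finitely generated modules are finitely generated: a cospan factors through the
weak push-out of its pullback, so `f x ⊗ g y` comes from one of finitely many weak push-outs.

The pairing of a free module with its dual is perfect, so `F* ⊗ M` is objectwise `Hom(F, M)`, and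
averaging over `G_c` identifies its coinvariants with the equivariant maps. -/

section Generation

variable {C : Type u} [Category.{v} C]

/-- The value at `d` of the `C`-submodule of `M` generated by a set `S` of elements of `M`. -/
def generatedSubmodule (M : C ⥤ ModuleCat.{w} ℂ) (S : Set (Σ c : C, M.obj c)) (d : C) :
    Submodule ℂ (M.obj d) :=
  Submodule.span ℂ {x | ∃ s ∈ S, ∃ f : s.1 ⟶ d, (M.map f).hom s.2 = x}

section

variable {M : C ⥤ ModuleCat.{w} ℂ} {S : Set (Σ c : C, M.obj c)}

theorem map_generator_mem_generatedSubmodule {s : Σ c : C, M.obj c} (hs : s ∈ S) {d : C}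
    (f : s.1 ⟶ d) : (M.map f).hom s.2 ∈ generatedSubmodule M S d :=
  Submodule.subset_span ⟨s, hs, f, rfl⟩

theorem map_mem_generatedSubmodule {c d : C} (f : c ⟶ d) {x : M.obj c}
    (hx : x ∈ generatedSubmodule M S c) : (M.map f).hom x ∈ generatedSubmodule M S d := by
  suffices h : generatedSubmodule M S c ≤ (generatedSubmodule M S d).comap (M.map f).hom from h hx
  refine Submodule.span_le.2 ?_
  rintro _ ⟨s, hs, g, rfl⟩
  have h := map_generator_mem_generatedSubmodule hs (g ≫ f)
  rwa [M.map_comp] at h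

theorem generatedSubmodule_le {N : ∀ c : C, Submodule ℂ (M.obj c)}
    (hN : ∀ (c d : C) (f : c ⟶ d), ∀ x ∈ N c, (M.map f).hom x ∈ N d)
    (hS : ∀ s ∈ S, s.2 ∈ N s.1) (d : C) : generatedSubmodule M S d ≤ N d := by
  refine Submodule.span_le.2 ?_
  rintro _ ⟨s, hs, f, rfl⟩
  exact hN _ _ f _ (hS s hs)

end

theorem isFinitelyGenerated_iff {M : C ⥤ ModuleCat.{w} ℂ} :
    IsFinitelyGenerated M ↔
      ∃ S : Set (Σ c : C, M.obj c), S.Finite ∧ ∀ d, generatedSubmodule M S d = ⊤ := by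
  constructor
  · rintro ⟨S, hS⟩
    refine ⟨S, S.finite_toSet, hS _ (fun _ _ f _ => map_mem_generatedSubmodule f) fun s hs => ?_⟩
    have h := map_generator_mem_generatedSubmodule (Finset.mem_coe.2 hs) (𝟙 s.1)
    rwa [M.map_id] at h
  · rintro ⟨S, hfin, hS⟩
    exact ⟨hfin.toFinset, fun N hN hSN d => top_le_iff.1 <|
      (hS d).ge.trans (generatedSubmodule_le hN (fun s hs => hSN s (hfin.mem_toFinset.2 hs)) d)⟩

theorem IsFinitelyGenerated.of_epi {M N : C ⥤ ModuleCat.{w} ℂ} (η : M ⟶ N) [Epi η]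
    (hM : IsFinitelyGenerated M) : IsFinitelyGenerated N := by
  classical
  obtain ⟨S, hS⟩ := hM
  refine ⟨S.image fun s => ⟨s.1, (η.app s.1).hom s.2⟩, fun K hK hSK c => ?_⟩
  have hcomap : (K c).comap (η.app c).hom = ⊤ := by
    refine hS (fun c => (K c).comap (η.app c).hom) (fun c d f x hx => ?_)
      (fun s hs => hSK _ (Finset.mem_image_of_mem _ hs)) c
    have hnat : (η.app d).hom ((M.map f).hom x) = (N.map f).hom ((η.app c).hom x) :=
      congrArg (fun k => k.hom x) (η.naturality f)
    rw [Submodule.mem_comap, hnat]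
    exact hK c d f _ hx
  have hsurj : LinearMap.range (η.app c).hom = ⊤ :=
    LinearMap.range_eq_top.2 ((ModuleCat.epi_iff_surjective _).1 inferInstance)
  rwa [← top_le_iff, ← hsurj, LinearMap.range_le_iff_comap]

theorem IsFinitelyGenerated.finite_obj {M : C ⥤ ModuleCat.{w} ℂ} (hM : IsFinitelyGenerated M)
    (d : C) [∀ c : C, Finite (c ⟶ d)] : Module.Finite ℂ (M.obj d) := by
  obtain ⟨S, hfin, hS⟩ := isFinitelyGenerated_iff.1 hM
  refine Module.finite_def.2 (hS d ▸ Submodule.fg_span ?_)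
  refine (hfin.biUnion fun s _ => Set.finite_range fun f : s.1 ⟶ d => (M.map f).hom s.2).subset ?_
  rintro _ ⟨s, hs, f, rfl⟩
  exact Set.mem_biUnion hs ⟨f, rfl⟩

end Generation

section TensorProduct

/-- A category has finite weak binary multicoproducts if any two objects have a finite weakly
initial set of cospans. This is what makes finitely generated modules closed under `⊗`. -/
class HasFiniteWeakMulticoproducts (C : Type u) [Category.{v} C] : Prop where
  exists_finite_cofans (c₁ c₂ : C) : ∃ S : Set (BinaryCofan c₁ c₂), S.Finite ∧
    ∀ t : BinaryCofan c₁ c₂, ∃ s ∈ S, Nonempty (s ⟶ t)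

variable {C : Type u} [Category.{v} C]

theorem IsFIType.exists_finset_forall_isPullback [IsFIType C] (c₁ : C) : ∃ B : Finset C,
    ∀ {c₂ d : C} (g₁ : c₁ ⟶ d) (g₂ : c₂ ⟶ d), ∃ p ∈ B, ∃ (f₁ : p ⟶ c₁) (f₂ : p ⟶ c₂),
      IsPullback f₁ f₂ g₁ g₂ := by
  have := IsFIType.hasPullbacks (C := C)
  obtain ⟨B, hB⟩ := IsFIType.finite_below c₁
  refine ⟨B, fun g₁ g₂ => ?_⟩
  obtain ⟨p, hp, ⟨i⟩⟩ := hB (pullback g₁ g₂) ⟨pullback.fst g₁ g₂⟩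
  exact ⟨p, hp, i.inv ≫ pullback.fst g₁ g₂, i.inv ≫ pullback.snd g₁ g₂,
    IsPullback.of_iso_pullback ⟨by simp [pullback.condition]⟩ i.symm rfl rfl⟩

/- A cospan factors through the weak push-out of its pullback, and up to isomorphism there are
only finitely many spans which can occur as that pullback. -/
instance [IsFIType C] : HasFiniteWeakMulticoproducts C where
  exists_finite_cofans c₁ c₂ := by
    obtain ⟨B, hB⟩ := IsFIType.exists_finset_forall_isPullback c₁
    choose d j₁ j₂ hj using fun p : C => fun f : (p ⟶ c₁) × (p ⟶ c₂) =>
      IsFIType.weakPushout f.1 f.2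
    have := IsFIType.finite_hom (C := C)
    refine ⟨⋃ p ∈ B, Set.range fun f => BinaryCofan.mk (j₁ p f) (j₂ p f),
      B.finite_toSet.biUnion fun p _ => Set.finite_range _, fun t => ?_⟩
    obtain ⟨p, hp, f₁, f₂, hpb⟩ := hB t.inl t.inr
    obtain ⟨h, ⟨hinl, hinr⟩, -⟩ := (hj p (f₁, f₂)).2 t.pt t.inl t.inr hpb
    refine ⟨_, Set.mem_biUnion hp ⟨(f₁, f₂), rfl⟩, ⟨⟨h, ?_⟩⟩⟩
    rintro ⟨⟨⟩⟩
    exacts [hinl, hinr]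

theorem IsFinitelyGenerated.tensor [HasFiniteWeakMulticoproducts C]
    {M : C ⥤ ModuleCat.{w₁} ℂ} {N : C ⥤ ModuleCat.{w₂} ℂ} (hM : IsFinitelyGenerated M)
    (hN : IsFinitelyGenerated N) : IsFinitelyGenerated (tensorModule M N) := by
  obtain ⟨S, hSfin, hS⟩ := isFinitelyGenerated_iff.1 hM
  obtain ⟨T, hTfin, hT⟩ := isFinitelyGenerated_iff.1 hN
  choose W hWfin hW using HasFiniteWeakMulticoproducts.exists_finite_cofans (C := C)
  let tmulAt (s : Σ c, M.obj c) (t : Σ c, N.obj c) (w : BinaryCofan s.1 t.1) :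
      Σ c, (tensorModule M N).obj c :=
    ⟨w.pt, (M.map w.inl).hom s.2 ⊗ₜ[ℂ] (N.map w.inr).hom t.2⟩
  let U := ⋃ s ∈ S, ⋃ t ∈ T, tmulAt s t '' W s.1 t.1
  have hUfin : U.Finite := hSfin.biUnion fun s _ => hTfin.biUnion fun t _ => (hWfin _ _).image _
  refine isFinitelyGenerated_iff.2 ⟨U, hUfin, fun d => top_le_iff.1 ?_⟩
  have htop : (⊤ : Submodule ℂ (M.obj d ⊗[ℂ] N.obj d)) =
      Submodule.map₂ (TensorProduct.mk ℂ (M.obj d) (N.obj d))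
        (generatedSubmodule M S d) (generatedSubmodule N T d) := by
    rw [hS, hT, TensorProduct.map₂_mk_top_top_eq_top]
  refine htop.le.trans ?_
  rw [generatedSubmodule, generatedSubmodule, Submodule.map₂_span_span]
  refine Submodule.span_le.2 ?_
  rintro _ ⟨_, ⟨s, hs, f, rfl⟩, _, ⟨t, ht, g, rfl⟩, rfl⟩
  obtain ⟨w, hw, h, rfl, rfl⟩ : ∃ w ∈ W s.1 t.1, ∃ h : w.pt ⟶ d, w.inl ≫ h = f ∧ w.inr ≫ h = g := by
    obtain ⟨w, hw, ⟨k⟩⟩ := hW s.1 t.1 (BinaryCofan.mk f g)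
    exact ⟨w, hw, k.hom, k.w ⟨WalkingPair.left⟩, k.w ⟨WalkingPair.right⟩⟩
  have hU : tmulAt s t w ∈ U :=
    Set.mem_biUnion hs (Set.mem_biUnion ht (Set.mem_image_of_mem _ hw))
  have hmap : ((tensorModule M N).map h).hom (tmulAt s t w).2 =
      (M.map (w.inl ≫ h)).hom s.2 ⊗ₜ[ℂ] (N.map (w.inr ≫ h)).hom t.2 := by
    rw [M.map_comp, N.map_comp]
    rfl
  exact Set.mem_of_eq_of_mem hmap.symm (map_generator_mem_generatedSubmodule hU h)

end TensorProduct

section Stabilization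

open Representation

variable {C : Type u} [Category.{v} C]

theorem exists_hom_forall_nonempty_hom_of_finite {B : Set C} (hB : B.Finite) (e : C) :
    ∃ c, Nonempty (e ⟶ c) ∧ ∀ b ∈ B, ∀ d, Nonempty (c ⟶ d) → Nonempty (b ⟶ d) →
      Nonempty (b ⟶ c) := by
  induction B, hB using Set.Finite.induction_on with
  | empty => exact ⟨e, ⟨𝟙 e⟩, by simp⟩
  | @insert a B _ _ ih =>
    obtain ⟨c, ⟨k⟩, hc⟩ := ih
    by_cases ha : ∃ d, Nonempty (c ⟶ d) ∧ Nonempty (a ⟶ d)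
    · obtain ⟨d, ⟨f⟩, had⟩ := ha
      refine ⟨d, ⟨k ≫ f⟩, ?_⟩
      rintro b (rfl | hb) d' ⟨g⟩ hbd'
      · exact had
      · exact (hc b hb d' ⟨f ≫ g⟩ hbd').map (· ≫ f)
    · refine ⟨c, ⟨k⟩, ?_⟩
      rintro b (rfl | hb) d hcd hbd
      · exact absurd ⟨d, hcd, hbd⟩ ha
      · exact hc b hb d hcd hbd

variable [IsFIType C] (M : C ⥤ ModuleCat.{w} ℂ)

theorem coinvMap_mk {c d : C} (f : c ⟶ d) (x : M.obj c) :
    coinvMap M f (Coinvariants.mk (autRep M c) x) =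
      Coinvariants.mk (autRep M d) ((M.map f).hom x) := rfl

theorem coinvMap_comp {c d e : C} (f : c ⟶ d) (g : d ⟶ e) :
    coinvMap M (f ≫ g) = coinvMap M g ∘ₗ coinvMap M f := by
  ext x
  simp [coinvMap_mk]

theorem coinvMap_eq_coinvMap {c d : C} (f g : c ⟶ d) : coinvMap M f = coinvMap M g := by
  obtain ⟨σ, rfl⟩ := IsFIType.transitive f g
  ext x
  have hσ : (M.map (f ≫ σ.hom)).hom x = autRep M d σ ((M.map f).hom x) := by
    rw [M.map_comp]; rfl
  simp only [LinearMap.comp_apply, coinvMap_mk, hσ, Coinvariants.mk_self_apply]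

variable {M}

theorem coinvMap_surjective {S : Set (Σ c : C, M.obj c)} {c d : C}
    (hS : generatedSubmodule M S d = ⊤) (f : c ⟶ d)
    (h : ∀ s ∈ S, Nonempty (s.1 ⟶ d) → Nonempty (s.1 ⟶ c)) :
    Function.Surjective (coinvMap M f) := by
  suffices hle : generatedSubmodule M S d ≤
      (LinearMap.range (coinvMap M f)).comap (Coinvariants.mk (autRep M d)) by
    intro y
    obtain ⟨x, rfl⟩ := Coinvariants.mk_surjective _ y
    exact hle (hS ▸ Submodule.mem_top)
  refine Submodule.span_le.2 ?_
  rintro _ ⟨s, hs, g, rfl⟩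
  obtain ⟨k⟩ := h s hs ⟨g⟩
  refine ⟨coinvMap M k (Coinvariants.mk _ s.2), ?_⟩
  rw [← LinearMap.comp_apply, ← coinvMap_comp, coinvMap_eq_coinvMap M (k ≫ f) g, coinvMap_mk]

theorem CoinvariantsStabilize.of_surjective (hfin : ∀ c, Module.Finite ℂ (Coinv M c))
    (hsurj : ∀ e : C, ∃ c, Nonempty (e ⟶ c) ∧ ∀ (d d' : C) (_ : c ⟶ d) (f : d ⟶ d'),
      Function.Surjective (coinvMap M f)) : CoinvariantsStabilize M := by
  refine ⟨{c | ∀ (d : C) (f : c ⟶ d), Function.Bijective (coinvMap M f)}, ?_, ?_, fun c hc => hc⟩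
  · rintro c d hc ⟨f⟩ e g
    have hcomp := hc e (f ≫ g)
    rw [coinvMap_comp, LinearMap.coe_comp] at hcomp
    exact (Function.Bijective.of_comp_iff _ (hc d f)).1 hcomp
  · intro e
    obtain ⟨c, ⟨k⟩, hc⟩ := hsurj e
    obtain ⟨d, ⟨l⟩, hmin⟩ := (measure fun d => Module.finrank ℂ (Coinv M d)).wf.has_min
      {d | Nonempty (c ⟶ d)} ⟨c, ⟨𝟙 c⟩⟩
    refine ⟨d, fun d' f => ?_, ⟨k ≫ l⟩⟩
    have hf := hc d d' l f
    have hfinrank : Module.finrank ℂ (Coinv M d) = Module.finrank ℂ (Coinv M d') :=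
      le_antisymm (not_lt.1 (hmin d' ⟨l ≫ f⟩)) (LinearMap.finrank_le_finrank_of_surjective hf)
    exact ⟨(LinearMap.injective_iff_surjective_of_finrank_eq_finrank hfinrank).2 hf, hf⟩

theorem IsFinitelyGenerated.coinvariantsStabilize (hM : IsFinitelyGenerated M) :
    CoinvariantsStabilize M := by
  have := IsFIType.finite_hom (C := C)
  refine .of_surjective (fun c => ?_) fun e => ?_
  · have := hM.finite_obj c
    infer_instance
  · obtain ⟨S, hSfin, hS⟩ := isFinitelyGenerated_iff.1 hM
    obtain ⟨c, hec, hc⟩ := exists_hom_forall_nonempty_hom_of_finite (hSfin.image Sigma.fst) e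
    refine ⟨c, hec, fun d d' k f => coinvMap_surjective (hS d') f fun s hs hsd' => ?_⟩
    exact (hc s.1 (Set.mem_image_of_mem _ hs) d' (hsd'.elim fun _ => ⟨k ≫ f⟩) hsd').map (· ≫ k)

end Stabilization

section Induction

variable {C : Type u} [Category.{v} C] {c : C} {V : Type w} [AddCommGroup V] [Module ℂ V]
  (ρ : Representation ℂ (Aut c) V) {d : C}

/-- The elementary tensor `f ⊗ x` of `Ind_c(V)_d`, as a linear function of `x`. -/
noncomputable def indTmul (f : c ⟶ d) : V →ₗ[ℂ] IndObj ρ d :=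
  (indRel ρ d).mkQ ∘ₗ Finsupp.lsingle f

theorem indTmul_comp (ψ : Aut c) (f : c ⟶ d) (x : V) :
    indTmul ρ (ψ.hom ≫ f) x = indTmul ρ f (ρ ψ x) :=
  (Submodule.Quotient.eq _).2 (Submodule.subset_span ⟨(ψ, f, x), rfl⟩)

theorem indMap_indTmul {e : C} (h : d ⟶ e) (f : c ⟶ d) (x : V) :
    indMap ρ h (indTmul ρ f x) = indTmul ρ (f ≫ h) x :=
  (indMap_mk ρ h _).trans (congrArg _ Finsupp.mapDomain_single)

variable {ρ} in
theorem indObj_hom_ext {W : Type*} [AddCommGroup W] [Module ℂ W] {L L' : IndObj ρ d →ₗ[ℂ] W}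
    (h : ∀ f : c ⟶ d, L ∘ₗ indTmul ρ f = L' ∘ₗ indTmul ρ f) : L = L' :=
  Submodule.linearMap_qext _ (Finsupp.lhom_ext' h)

open Classical in
theorem indPairing_indTmul [IsFIType C] (f g : c ⟶ d) (φ : Module.Dual ℂ V) (x : V) :
    indPairing ρ d (indTmul ρ.dual f φ) (indTmul ρ g x) =
      ∑ ψ : Aut c, if ψ.hom ≫ f = g then φ (ρ ψ x) else 0 :=
  rawPairing_single ρ d f g φ x

variable (d) in
/-- The inverse `l ↦ |G_c|⁻¹ ∑_f f ⊗ l (f ⊗ -)` of the pairing, seen as a map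
`Ind_c(V*)_d → (Ind_c(V)_d)*`. -/
noncomputable def indPairingInv [Fintype (c ⟶ d)] :
    Module.Dual ℂ (IndObj ρ d) →ₗ[ℂ] IndObj ρ.dual d :=
  (Nat.card (Aut c) : ℂ)⁻¹ • ∑ f : c ⟶ d, indTmul ρ.dual f ∘ₗ (indTmul ρ f).dualMap

theorem indPairingInv_apply [Fintype (c ⟶ d)] (l : Module.Dual ℂ (IndObj ρ d)) :
    indPairingInv ρ d l =
      (Nat.card (Aut c) : ℂ)⁻¹ • ∑ f : c ⟶ d, indTmul ρ.dual f (l ∘ₗ indTmul ρ f) := by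
  simp only [indPairingInv, LinearMap.smul_apply, LinearMap.sum_apply]
  rfl

variable [IsFIType C]

theorem indPairingInv_indPairing [Fintype (c ⟶ d)] (a : IndObj ρ.dual d) :
    indPairingInv ρ d (indPairing ρ d a) = a := by
  classical
  suffices h : indPairingInv ρ d ∘ₗ indPairing ρ d = LinearMap.id from LinearMap.congr_fun h a
  refine indObj_hom_ext fun f => LinearMap.ext fun φ => ?_
  have hcomp (g : c ⟶ d) : indPairing ρ d (indTmul ρ.dual f φ) ∘ₗ indTmul ρ g =
      ∑ ψ : Aut c, if ψ.hom ≫ f = g then φ ∘ₗ ρ ψ else 0 := by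
    ext x
    simp only [LinearMap.comp_apply, indPairing_indTmul, LinearMap.sum_apply]
    exact Finset.sum_congr rfl fun ψ _ => by split_ifs <;> rfl
  have hterm (ψ : Aut c) : indTmul ρ.dual (ψ.hom ≫ f) (φ ∘ₗ ρ ψ) = indTmul ρ.dual f φ := by
    rw [indTmul_comp]
    refine congrArg _ (LinearMap.ext fun x => ?_)
    simp [Module.Dual.transpose_apply]
  simp only [LinearMap.comp_apply, indPairingInv_apply, hcomp, map_sum, LinearMap.id_apply]
  rw [Finset.sum_comm]
  simp [apply_ite, hterm, ← Nat.cast_smul_eq_nsmul ℂ]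

theorem indPairing_indPairingInv [Fintype (c ⟶ d)] (l : Module.Dual ℂ (IndObj ρ d)) :
    indPairing ρ d (indPairingInv ρ d l) = l := by
  classical
  refine indObj_hom_ext fun g => LinearMap.ext fun x => ?_
  have hterm (f : c ⟶ d) (ψ : Aut c) :
      (if ψ.hom ≫ f = g then l (indTmul ρ f (ρ ψ x)) else 0) =
        if f = ψ.inv ≫ g then l (indTmul ρ g x) else 0 := by
    have hψ : ψ.hom ≫ f = g ↔ f = ψ.inv ≫ g := (Iso.eq_inv_comp (show c ≅ c from ψ)).symm
    simp only [← indTmul_comp, hψ]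
    split_ifs with h
    · rw [hψ.2 h]
    · rfl
  simp only [indPairingInv_apply, LinearMap.comp_apply, map_smul, map_sum, LinearMap.smul_apply,
    LinearMap.sum_apply, indPairing_indTmul, hterm]
  rw [Finset.sum_comm]
  simp

theorem indPairing_bijective (d : C) : Function.Bijective (indPairing ρ d) := by
  have := IsFIType.finite_hom c d
  have := Fintype.ofFinite (c ⟶ d)
  exact Function.bijective_iff_has_inverse.2
    ⟨indPairingInv ρ d, indPairingInv_indPairing ρ, indPairing_indPairingInv ρ⟩

end Induction

section FreeModules

namespace FreeData

variable {C : Type u} [Category.{v} C] (P : FreeData.{u, v, w} C) {d : C}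

/-- The element `f ⊗ x` of the `i`-th summand of the free module, as a linear function of `x`. -/
noncomputable def tmul (i : Fin P.n) (f : P.base i ⟶ d) : P.V i →ₗ[ℂ] P.toModule.obj d :=
  LinearMap.single ℂ (fun i => IndObj (P.rep i) d) i ∘ₗ indTmul (P.rep i) f

theorem map_tmul {e : C} (h : d ⟶ e) (i : Fin P.n) (f : P.base i ⟶ d) (x : P.V i) :
    (P.toModule.map h).hom (P.tmul i f x) = P.tmul i (f ≫ h) x := by
  refine funext fun k => ?_
  have hsingle := Pi.apply_single (fun j => indMap (P.rep j) h) (fun j => map_zero _) i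
    (indTmul (P.rep i) f x) k
  rw [indMap_indTmul] at hsingle
  exact hsingle

variable {P} in
theorem toModule_hom_ext {W : Type*} [AddCommGroup W] [Module ℂ W]
    {L L' : P.toModule.obj d →ₗ[ℂ] W} (h : ∀ i f, L ∘ₗ P.tmul i f = L' ∘ₗ P.tmul i f) : L = L' :=
  LinearMap.pi_ext' fun i => indObj_hom_ext (h i)

theorem isFinitelyGenerated_toModule : IsFinitelyGenerated P.toModule := by
  let b i := Module.finBasis ℂ (P.V i)
  let gen (t : Σ i, Fin (Module.finrank ℂ (P.V i))) : Σ c, P.toModule.obj c :=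
    ⟨P.base t.1, P.tmul t.1 (𝟙 _) (b t.1 t.2)⟩
  refine isFinitelyGenerated_iff.2 ⟨Set.range gen, Set.finite_range gen, fun d => ?_⟩
  have hmem (i : Fin P.n) (f : P.base i ⟶ d) (j : Fin (Module.finrank ℂ (P.V i))) :
      P.tmul i f (b i j) ∈ generatedSubmodule P.toModule (Set.range gen) d := by
    have hgen : (P.toModule.map f).hom (gen ⟨i, j⟩).2 = P.tmul i f (b i j) := by
      rw [P.map_tmul, Category.id_comp]
    rw [← hgen]
    exact map_generator_mem_generatedSubmodule (Set.mem_range_self (f := gen) ⟨i, j⟩) f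
  rw [← Submodule.ker_mkQ (generatedSubmodule _ _ d), LinearMap.ker_eq_top]
  exact toModule_hom_ext fun i f => (b i).ext fun j =>
    (Submodule.Quotient.mk_eq_zero _).2 (hmem i f j)

variable [IsFIType C]

theorem pairing_bijective (d : C) : Function.Bijective (P.pairing d) := by
  have hpairing : ⇑(P.pairing d) = LinearMap.lsum ℂ (fun i => IndObj (P.rep i) d) ℂ ∘
      Pi.map fun i => indPairing (P.rep i) d := by
    funext a
    simp only [pairing, LinearMap.sum_apply]
    rfl
  rw [hpairing]
  exact (LinearEquiv.bijective _).comp (.piMap fun i => indPairing_bijective (P.rep i) d)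

end FreeData

end FreeModules

section Average

open Representation

theorem coinvariants_mk_sum_apply {k G V : Type*} [CommRing k] [Group G] [Fintype G]
    [AddCommGroup V] [Module k V] (ρ : Representation k G V) (x : V) :
    Coinvariants.mk ρ (∑ g, ρ g x) = Fintype.card G • Coinvariants.mk ρ x := by
  simp

variable {G V W : Type*} [Group G] [Fintype G] [AddCommGroup V] [Module ℂ V] [AddCommGroup W]
  [Module ℂ W] (ρ : Representation ℂ G V) (σ : Representation ℂ G W)

theorem averageHom_toLinearMap (T : V →ₗ[ℂ] W) :
    (averageHom ρ σ T).toLinearMap = (Fintype.card G : ℂ)⁻¹ • ∑ g : G, ρ.linHom σ g T := by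
  rw [← LinearMap.sum_apply]
  rfl

theorem averageHom_eq_zero_iff {T : V →ₗ[ℂ] W} :
    averageHom ρ σ T = 0 ↔ ∑ g : G, ρ.linHom σ g T = 0 := by
  rw [← (IntertwiningMap.toLinearMap_injective ρ σ).eq_iff, averageHom_toLinearMap]
  exact smul_eq_zero_iff_right (by simp)

theorem averageHom_intertwiningMap (T : ρ.IntertwiningMap σ) :
    averageHom ρ σ T.toLinearMap = T := by
  refine IntertwiningMap.toLinearMap_injective ρ σ ?_
  have hT (g : G) : ρ.linHom σ g T.toLinearMap = T.toLinearMap :=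
    ((invariantsEquivIntertwiningMap ρ σ).symm T).2 g
  change (averageHom ρ σ T.toLinearMap).toLinearMap = T.toLinearMap
  simp [averageHom_toLinearMap, hT, ← Nat.cast_smul_eq_nsmul ℂ]

end Average

section Hom

open Representation

variable {C : Type u} [Category.{v} C] [IsFIType C] {F : C ⥤ ModuleCat.{max v w} ℂ}
  (P : FreeData.{u, v, w} C) (e : F ≅ P.toModule) (M : C ⥤ ModuleCat.{w₁} ℂ) (d : C)

theorem contraction_bijective : Function.Bijective (contraction P e M d) := by
  have := fun c => IsFIType.finite_hom c d
  have : Module.Finite ℂ (F.obj d) :=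
    (P.isFinitelyGenerated_toModule.of_epi e.inv).finite_obj d
  have hpairing : Function.Bijective ((P.pairing d).compl₂ (e.hom.app d).hom) :=
    (e.app d).toLinearEquiv.dualMap.bijective.comp (P.pairing_bijective d)
  exact (dualTensorHom_bijective ..).comp
    ((LinearEquiv.ofBijective _ hpairing).rTensor (M.obj d)).bijective

theorem coinvToHom_bijective : Function.Bijective (coinvToHom P e M d) := by
  constructor
  · refine (injective_iff_map_eq_zero _).2 fun y hy => ?_
    obtain ⟨t, rfl⟩ := Coinvariants.mk_surjective _ y
    have hsum : ∑ g, autRep (tensorModule P.dual.toModule M) d g t = 0 := by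
      refine (contraction_bijective P e M d).1 ?_
      simp only [map_sum, contraction_autRep, map_zero]
      exact (averageHom_eq_zero_iff _ _).1 hy
    have hcard := coinvariants_mk_sum_apply (autRep (tensorModule P.dual.toModule M) d) t
    rw [hsum, map_zero, ← Nat.cast_smul_eq_nsmul ℂ] at hcard
    exact (smul_eq_zero.1 hcard.symm).resolve_left (by simp)
  · intro T
    obtain ⟨t, ht⟩ := (contraction_bijective P e M d).2 T.toLinearMap
    exact ⟨Coinvariants.mk _ t, (congrArg _ ht).trans (averageHom_intertwiningMap _ _ T)⟩

end Hom

theorem mainTheorem6 {C : Type u} [Category.{v} C] [IsFIType C]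
    (M : C ⥤ ModuleCat.{w₁} ℂ) (hM : IsFinitelyGenerated M) :
    CoinvariantsStabilize M ∧
    (∀ F : C ⥤ ModuleCat.{max v w} ℂ, IsFreeModule.{u, v, w} F →
      CoinvariantsStabilize (tensorModule F M)) ∧
    (∀ (F : C ⥤ ModuleCat.{max v w} ℂ) (P : FreeData.{u, v, w} C) (e : F ≅ P.toModule),
      (∀ c : C, Function.Bijective (coinvToHom P e M c)) ∧
      ∃ X : Set C, IsUpwardClosed X ∧ IsCofinalSet X ∧
        ∀ c ∈ X, ∀ (d : C) (f : c ⟶ d),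
          ∃ Ψ : (autRep F c).IntertwiningMap (autRep M c) ≃ₗ[ℂ]
              (autRep F d).IntertwiningMap (autRep M d),
            ∀ x : Coinv (tensorModule P.dual.toModule M) c,
              Ψ (coinvToHom P e M c x) =
                coinvToHom P e M d (coinvMap (tensorModule P.dual.toModule M) f x)) := by
  refine ⟨hM.coinvariantsStabilize, ?_, fun F P e => ⟨coinvToHom_bijective P e M, ?_⟩⟩
  · rintro F ⟨P, ⟨e⟩⟩
    exact ((P.isFinitelyGenerated_toModule.of_epi e.inv).tensor hM).coinvariantsStabilize
  · obtain ⟨X, hup, hcof, hX⟩ :=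
      (P.dual.isFinitelyGenerated_toModule.tensor hM).coinvariantsStabilize
    refine ⟨X, hup, hcof, fun c hc d f => ?_⟩
    let α (c : C) := LinearEquiv.ofBijective _ (coinvToHom_bijective P e M c)
    refine ⟨(α c).symm ≪≫ₗ LinearEquiv.ofBijective _ (hX c hc d f) ≪≫ₗ α d, fun x => ?_⟩
    exact congrArg (fun y => α d (coinvMap _ f y)) ((α c).symm_apply_apply x)
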